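/- **Definitions.** Let $A$ be a unital C*-algebra and $\mathcal S(A)$ its state space with the weak* topology. A *Lipschitz seminorm* on $A$ is a seminorm $L:A\to[0,\infty]$ such that $L(a^*)=L(a)$ for all $a$, $L(a)=0$ if and only if $a\in\mathbb C\mathbf 1_A$, and $\operatorname{dom}(L)=\{a\in A: L(a)<\infty\}$ is dense in $A$. Put $\rho_L(\mu,\nu)=\sup\{|\mu(a)-\nu(a)| : a\in A,\ L(a)\le 1\}$ for $\mu,\nu\in\mathcal S(A)$. $L$ is a *Lip-norm* if it is a Lipschitz seminorm and the topology of $\rho_L$ on $\mathcal S(A)$ is the weak* topology. An *inductive sequence of compact quantum metric spaces* $\{((A_n,L_n),\phi_n)\}_{n\ge1}$ consists of unital C*-algebras $A_n$ with Lip-norms $L_n$ and unital $*$-homomorphisms $\phi_n:A_n\to A_{n+1}$ with $\phi_n(\operatorname{dom}(L_n))\subseteq\operatorname{dom}(L_{n+1})$. Let $A=\varinjlim(A_n,\phi_n)$ be the C*-algebraic inductive limit, with canonical maps $\phi^n:A_n\to A$. Its state space carries the metric $$\rho(\mu,\nu)=\sum_{n=1}^\infty\frac1{2^n}\,\frac{\rho_{L_n}(\mu\circ\phi^n,\nu\circ\phi^n)}{1+\rho_{L_n}(\mu\circ\phi^n,\nu\circ\phi^n)},$$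 and $A$ carries the seminorm $$L_A(a)=\sup\Big\{\frac{|\mu(a)-\nu(a)|}{\rho(\mu,\nu)}:\ \mu,\nu\in\mathcal S(A),\ \mu\ne\nu\Big\}\in[0,\infty].$$ **Proposition 4.5.** Let $\{((A_n,L_{A_n}),\phi_n)\}$ and $\{((B_n,L_{B_n}),\varphi_n)\}$ be two inductive sequences of compact quantum metric spaces, with limits $A$, $B$ and canonical maps $\phi^n:A_n\to A$, $\varphi^n:B_n\to B$, and let $L_A$ be the seminorm on $A$ defined above. Suppose that for each $n$ there is a unital $*$-homomorphism $\psi_n:A_n\to B_n$ such that $\psi_{n+1}\circ\phi_n=\varphi_n\circ\psi_n$ for all $n$. Let $L_B$ be any lower semicontinuous Lip-norm on $B$ (not necessarily the one given by the above formula), and let $\{\gamma_n\}$ be a bounded sequence of real numbers such that $$L_B\big((\varphi^n\circ\psi_n)(a)\big)\le\gamma_n L_{A_n}(a)\qquad\text{for all } n \text{ and all } a\in A_n .$$ Then there is a unique unital $*$-homomorphism $\psi:A\to B$ such that $\psi\circ\phi^n=\varphi^n\circ\psi_n$ for all $n$, and it satisfies $$L_B(\psi(a))\le 2\sup\{\gamma_n:n\in\mathbb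 N\}\,L_A(a)\qquad\text{for all } a\in A .$$ -/

import Mathlib

open Filter Topology
open scoped ENNReal

universe u v

noncomputable section

namespace QMS

/-! ## Completion of a `ℂ`-algebra with a C*-seminorm -/

section Completion

open UniformSpace

variable {R : Type u} [SeminormedRing R] [StarRing R] [NormedAlgebra ℂ R] [StarModule ℂ R]

theorem norm_star_of_cstar (h : ∀ x : R, ‖star x * x‖ = ‖x‖ * ‖x‖) (x : R) : ‖star x‖ = ‖x‖ := by
  have key : ∀ y : R, ‖y‖ ≤ ‖star y‖ := fun y => by
    by_contra hlt
    push Not at hlt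
    have h1 : ‖y‖ * ‖y‖ ≤ ‖star y‖ * ‖y‖ := (h y).symm.le.trans (norm_mul_le _ _)
    have h2 : 0 < ‖y‖ := (norm_nonneg _).trans_lt hlt
    nlinarith
  refine le_antisymm ?_ (key x)
  simpa using key (star x)

theorem uniformContinuous_star_of_cstar (h : ∀ x : R, ‖star x * x‖ = ‖x‖ * ‖x‖) :
    UniformContinuous (star : R → R) := by
  refine (AddMonoidHomClass.isometry_of_norm (starAddEquiv : R ≃+ R) fun x => ?_).uniformContinuous
  simpa using norm_star_of_cstar h x

/-- The Hausdorff completion of a unital complex *-algebra `R` with respect to a submultiplicative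
C*-seminorm is a unital C*-algebra; the involution is the extension of that of `R` by continuity
(this is the enveloping C*-algebra of `R` for that seminorm). -/
abbrev completionCStarAlgebra (h : ∀ x : R, ‖star x * x‖ = ‖x‖ * ‖x‖) :
    CStarAlgebra (Completion R) :=
  have hs := uniformContinuous_star_of_cstar h
  have hc : Continuous (Completion.map (star : R → R)) := Completion.continuous_map
  { (inferInstance : NormedRing (Completion R)),
    (inferInstance : Algebra ℂ (Completion R)) with
    star := Completion.map star
    star_involutive := fun x => by
      induction x using Completion.induction_on with
      | hp => exact isClosed_eq (hc.comp hc) continuous_id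
      | ih a => simp [Completion.map_coe hs]
    star_mul := fun x y => by
      induction x, y using Completion.induction_on₂ with
      | hp => exact isClosed_eq (hc.comp continuous_mul)
                ((hc.comp continuous_snd).mul (hc.comp continuous_fst))
      | ih a b => simp [Completion.map_coe hs, ← Completion.coe_mul]
    star_add := fun x y => by
      induction x, y using Completion.induction_on₂ with
      | hp => exact isClosed_eq (hc.comp continuous_add)
                ((hc.comp continuous_fst).add (hc.comp continuous_snd))
      | ih a b => simp [Completion.map_coe hs, ← Completion.coe_add]
    star_smul := fun r x => by
      induction x using Completion.induction_on with
      | hp => exact isClosed_eq (hc.comp (continuous_const_smul r)) ((continuous_const_smul (star r)).comp hc)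
      | ih a => simp [Completion.map_coe hs, ← Completion.coe_smul]
    norm_mul_self_le := fun x => by
      induction x using Completion.induction_on with
      | hp => exact isClosed_le (continuous_norm.mul continuous_norm)
                (continuous_norm.comp (hc.mul continuous_id))
      | ih a =>
        change ‖(a : Completion R)‖ * ‖(a : Completion R)‖ ≤
          ‖Completion.map star (a : Completion R) * (a : Completion R)‖
        rw [Completion.map_coe hs, ← Completion.coe_mul, Completion.norm_coe,
          Completion.norm_coe, h]
    norm_smul_le := fun r x => norm_smul_le r x
    complete := fun hf => CompleteSpace.complete hf }

end Completion

/-! ## The inductive limit of a sequence of unital C*-algebras -/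

section Limit

variable {A : ℕ → Type u} [∀ n, CStarAlgebra (A n)] (φ : ∀ n, A n →⋆ₐ[ℂ] A (n + 1))

/-- The *-algebra of all sequences `(x n)` with `φ n (x n) = x (n + 1)` for all large `n`. -/
def coherent : StarSubalgebra ℂ (∀ n, A n) where
  carrier := {x | ∀ᶠ n in atTop, φ n (x n) = x (n + 1)}
  mul_mem' := fun hx hy => by
    filter_upwards [hx, hy] with n h1 h2
    simp [h1, h2]
  add_mem' := fun hx hy => by
    filter_upwards [hx, hy] with n h1 h2
    simp [h1, h2]
  algebraMap_mem' := fun r => Eventually.of_forall fun n => AlgHomClass.commutes (φ n) r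
  star_mem' := fun hx => by
    filter_upwards [hx] with n h1
    simp [h1, map_star]

/-- The type of eventually coherent sequences, to be equipped with the seminorm `lim ‖x n‖`. -/
def PreLimit : Type u := coherent φ

instance : Ring (PreLimit φ) := inferInstanceAs (Ring (coherent φ))
instance : Algebra ℂ (PreLimit φ) := inferInstanceAs (Algebra ℂ (coherent φ))
instance : StarRing (PreLimit φ) := inferInstanceAs (StarRing (coherent φ))
instance : StarModule ℂ (PreLimit φ) := inferInstanceAs (StarModule ℂ (coherent φ))

variable {φ}

/-- The `n`-th term of an eventually coherent sequence. -/
def PreLimit.term (x : PreLimit φ) (n : ℕ) : A n := Subtype.val (p := (· ∈ coherent φ)) x n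

theorem PreLimit.eventually_coherent (x : PreLimit φ) :
    ∀ᶠ n in atTop, φ n (x.term n) = x.term (n + 1) :=
  Subtype.prop (p := (· ∈ coherent φ)) x

theorem PreLimit.exists_tendsto (x : PreLimit φ) :
    ∃ r : ℝ, Tendsto (fun n => ‖x.term n‖) atTop (𝓝 r) := by
  obtain ⟨N, hN⟩ := eventually_atTop.1 x.eventually_coherent
  have hanti : Antitone fun k => ‖x.term (k + N)‖ := by
    refine antitone_nat_of_succ_le fun k => ?_
    have := NonUnitalStarAlgHom.norm_apply_le (φ (k + N)) (x.term (k + N))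
    rw [hN (k + N) (by omega)] at this
    rwa [show k + 1 + N = k + N + 1 by omega]
  refine ⟨_, (tendsto_add_atTop_iff_nat N).1 (tendsto_atTop_ciInf hanti ⟨0, ?_⟩)⟩
  rintro _ ⟨k, rfl⟩
  exact norm_nonneg _

variable (φ)

/-- The C*-seminorm `x ↦ lim ‖x n‖`. -/
instance : Norm (PreLimit φ) := ⟨fun x => limUnder atTop fun n => ‖x.term n‖⟩

variable {φ}

theorem PreLimit.tendsto_norm (x : PreLimit φ) :
    Tendsto (fun n => ‖x.term n‖) atTop (𝓝 ‖x‖) :=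
  tendsto_nhds_limUnder x.exists_tendsto

variable (φ)

/-- `lim ‖x n‖` as a seminorm on the additive group of eventually coherent sequences. -/
def preLimitSeminorm : AddGroupSeminorm (PreLimit φ) where
  toFun x := ‖x‖
  map_zero' := by
    refine tendsto_nhds_unique (PreLimit.tendsto_norm (0 : PreLimit φ)) ?_
    exact tendsto_const_nhds.congr fun n => (norm_zero (E := A n)).symm
  add_le' x y := le_of_tendsto_of_tendsto' (PreLimit.tendsto_norm (x + y))
    (x.tendsto_norm.add y.tendsto_norm) fun n => norm_add_le (x.term n) (y.term n)
  neg' x := tendsto_nhds_unique (PreLimit.tendsto_norm (-x))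
    (x.tendsto_norm.congr fun n => (norm_neg (x.term n)).symm)

instance : SeminormedRing (PreLimit φ) :=
  { (inferInstance : Ring (PreLimit φ)), (preLimitSeminorm φ).toSeminormedAddCommGroup with
    norm_mul_le := fun x y => le_of_tendsto_of_tendsto' (PreLimit.tendsto_norm (x * y))
      (x.tendsto_norm.mul y.tendsto_norm) fun n => norm_mul_le (x.term n) (y.term n) }

instance : NormedAlgebra ℂ (PreLimit φ) where
  norm_smul_le r x := le_of_tendsto_of_tendsto' (PreLimit.tendsto_norm (r • x))
    (x.tendsto_norm.const_mul ‖r‖) fun n => norm_smul_le r (x.term n)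

theorem PreLimit.norm_star_mul_self (x : PreLimit φ) : ‖star x * x‖ = ‖x‖ * ‖x‖ :=
  tendsto_nhds_unique (PreLimit.tendsto_norm (star x * x))
    ((x.tendsto_norm.mul x.tendsto_norm).congr fun n =>
      (CStarRing.norm_star_mul_self (x := x.term n)).symm)

/-- The inductive limit of the sequence `A 0 → A 1 → A 2 → ⋯` of unital C*-algebras: the Hausdorff
completion of the *-algebra of eventually coherent sequences for the C*-seminorm `lim ‖x n‖`. -/
def CStarLimit : Type u := UniformSpace.Completion (PreLimit φ)

instance : CStarAlgebra (CStarLimit φ) :=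
  completionCStarAlgebra (PreLimit.norm_star_mul_self φ)

/-- The canonical image in the limit of an eventually coherent sequence. -/
def ofPre (x : PreLimit φ) : CStarLimit φ := UniformSpace.Completion.coe' x

theorem norm_ofPre (x : PreLimit φ) : ‖ofPre φ x‖ = ‖x‖ := UniformSpace.Completion.norm_coe x

theorem ofPre_add (x y : PreLimit φ) : ofPre φ (x + y) = ofPre φ x + ofPre φ y :=
  UniformSpace.Completion.coe_add x y

theorem ofPre_sub (x y : PreLimit φ) : ofPre φ (x - y) = ofPre φ x - ofPre φ y :=
  UniformSpace.Completion.coe_sub x y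

theorem ofPre_mul (x y : PreLimit φ) : ofPre φ (x * y) = ofPre φ x * ofPre φ y :=
  UniformSpace.Completion.coe_mul x y

theorem ofPre_star (x : PreLimit φ) : ofPre φ (star x) = star (ofPre φ x) :=
  (UniformSpace.Completion.map_coe
    (uniformContinuous_star_of_cstar (PreLimit.norm_star_mul_self φ)) x).symm

theorem ofPre_algebraMap (r : ℂ) :
    ofPre φ (algebraMap ℂ (PreLimit φ) r) = algebraMap ℂ (CStarLimit φ) r := rfl

variable {φ} in
theorem ofPre_eq_of_eventuallyEq {x y : PreLimit φ}
    (h : ∀ᶠ n in atTop, x.term n = y.term n) : ofPre φ x = ofPre φ y := by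
  rw [← sub_eq_zero, ← ofPre_sub, ← norm_eq_zero, norm_ofPre]
  refine tendsto_nhds_unique (PreLimit.tendsto_norm (x - y)) (tendsto_const_nhds.congr' ?_)
  filter_upwards [h] with n hn
  exact (norm_eq_zero.2 (sub_eq_zero.2 hn)).symm

/-- The composite `φ (m - 1) ∘ ⋯ ∘ φ n : A n → A m` of connecting maps, for `n ≤ m`. -/
def transition {n m : ℕ} (h : n ≤ m) : A n → A m := Nat.leRecOn h fun {k} => φ k

theorem transition_self {n : ℕ} (h : n ≤ n) (a : A n) : transition φ h a = a :=
  Nat.leRecOn_self a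

theorem transition_succ {n m : ℕ} (h : n ≤ m) (h' : n ≤ m + 1) (a : A n) :
    transition φ h' a = φ m (transition φ h a) :=
  Nat.leRecOn_succ h a

theorem transition_succ_left {n m : ℕ} (h : n ≤ m) (h' : n + 1 ≤ m) (a : A n) :
    transition φ h' (φ n a) = transition φ h a :=
  Nat.leRecOn_succ_left (C := A) (next := fun {k} => φ k) a h h'

/-- The eventually coherent sequence `(0, …, 0, a, φ n a, φ (n + 1) (φ n a), …)`. -/
def orbit (n : ℕ) (a : A n) : PreLimit φ :=
  Subtype.mk (p := (· ∈ coherent φ))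
    (fun m => if h : n ≤ m then transition φ h a else 0) <| by
      change ∀ᶠ m in atTop, _
      filter_upwards [eventually_ge_atTop n] with m hm
      rw [dif_pos hm, dif_pos (hm.trans m.le_succ), transition_succ φ hm]

theorem orbit_term {n m : ℕ} (h : n ≤ m) (a : A n) :
    (orbit φ n a).term m = transition φ h a := dif_pos h

variable {φ} in
theorem ofPre_orbit_eq {n : ℕ} {a : A n} {y : PreLimit φ} (h₀ : y.term n = a)
    (h : ∀ m, n ≤ m → φ m (y.term m) = y.term (m + 1)) : ofPre φ (orbit φ n a) = ofPre φ y := by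
  refine ofPre_eq_of_eventuallyEq ?_
  filter_upwards [eventually_ge_atTop n] with m hm
  rw [orbit_term φ hm]
  induction m, hm using Nat.le_induction with
  | base => rw [transition_self, h₀]
  | succ m hm ih => rw [transition_succ φ hm, ih, h m hm]

theorem orbit_coherent {n m : ℕ} (h : n ≤ m) (a : A n) :
    φ m ((orbit φ n a).term m) = (orbit φ n a).term (m + 1) := by
  rw [orbit_term φ h, orbit_term φ (h.trans m.le_succ), transition_succ φ h]

theorem orbit_term_self (n : ℕ) (a : A n) : (orbit φ n a).term n = a := by
  rw [orbit_term φ le_rfl, transition_self]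

theorem ofPre_orbit_algebraMap (n : ℕ) (r : ℂ) :
    ofPre φ (orbit φ n (algebraMap ℂ (A n) r)) = algebraMap ℂ (CStarLimit φ) r := by
  rw [← ofPre_algebraMap]
  refine ofPre_orbit_eq (y := algebraMap ℂ (PreLimit φ) r) rfl fun m _ => ?_
  exact AlgHomClass.commutes (φ m) r

/-- The canonical unital *-homomorphism `A n → lim A`. -/
def limMap (n : ℕ) : A n →⋆ₐ[ℂ] CStarLimit φ where
  toFun a := ofPre φ (orbit φ n a)
  map_one' := by simpa using ofPre_orbit_algebraMap φ n 1
  map_zero' := by simpa using ofPre_orbit_algebraMap φ n 0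
  commutes' r := ofPre_orbit_algebraMap φ n r
  map_mul' a b := by
    rw [← ofPre_mul]
    refine ofPre_orbit_eq (y := orbit φ n a * orbit φ n b) ?_ fun m hm => ?_
    · exact congr_arg₂ (· * ·) (orbit_term_self φ n a) (orbit_term_self φ n b)
    · exact (map_mul (φ m) _ _).trans
        (congr_arg₂ (· * ·) (orbit_coherent φ hm a) (orbit_coherent φ hm b))
  map_add' a b := by
    rw [← ofPre_add]
    refine ofPre_orbit_eq (y := orbit φ n a + orbit φ n b) ?_ fun m hm => ?_
    · exact congr_arg₂ (· + ·) (orbit_term_self φ n a) (orbit_term_self φ n b)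
    · exact (map_add (φ m) _ _).trans
        (congr_arg₂ (· + ·) (orbit_coherent φ hm a) (orbit_coherent φ hm b))
  map_star' a := by
    rw [← ofPre_star]
    refine ofPre_orbit_eq (y := star (orbit φ n a)) ?_ fun m hm => ?_
    · exact congr_arg star (orbit_term_self φ n a)
    · exact (map_star (φ m) _).trans (congr_arg star (orbit_coherent φ hm a))

/-- The canonical maps are compatible with the connecting maps. -/
theorem limMap_succ (n : ℕ) : (limMap φ (n + 1)).comp (φ n) = limMap φ n := by
  refine StarAlgHom.ext fun a => Eq.symm ?_
  refine ofPre_eq_of_eventuallyEq ?_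
  filter_upwards [eventually_ge_atTop (n + 1)] with m hm
  rw [orbit_term φ hm, orbit_term φ (n.le_succ.trans hm), ← transition_succ_left φ _ hm]
  rfl

/-- The norm of the image of `a : A n` in the limit is the limit of the norms of its images. -/
theorem tendsto_norm_limMap (n : ℕ) (a : A n) :
    Tendsto (fun k => ‖transition φ (Nat.le_add_right n k) a‖) atTop (𝓝 ‖limMap φ n a‖) := by
  have h : ‖limMap φ n a‖ = ‖orbit φ n a‖ := norm_ofPre φ _
  rw [h]
  refine (((tendsto_add_atTop_iff_nat n).2 (orbit φ n a).tendsto_norm)).congr fun k => ?_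
  rw [add_comm k n, orbit_term φ (Nat.le_add_right n k)]

/-- The images of the `A n` exhaust a dense subset of the limit. -/
theorem dense_iUnion_range_limMap : Dense (⋃ n, Set.range (limMap φ n)) := by
  have hd : DenseRange (ofPre φ) := UniformSpace.Completion.denseRange_coe
  refine hd.mono ?_
  rintro _ ⟨x, rfl⟩
  obtain ⟨N, hN⟩ := eventually_atTop.1 x.eventually_coherent
  exact Set.mem_iUnion.2 ⟨N, x.term N, ofPre_orbit_eq rfl hN⟩

end Limit

/-! ## States, Lip-norms and compact quantum metric spaces -/

section Lip

variable {A : Type u} [CStarAlgebra A] {B : Type v} [CStarAlgebra B]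

variable (A) in
/-- The state space: positive functionals `μ` with `μ 1 = 1`, with the weak* topology. -/
def StateSpace : Type u :=
  {μ : WeakDual ℂ A // μ 1 = 1 ∧ ∀ a : A, 0 ≤ (μ (star a * a)).re ∧ (μ (star a * a)).im = 0}

instance : TopologicalSpace (StateSpace A) :=
  instTopologicalSpaceSubtype

instance : CoeFun (StateSpace A) fun _ => A → ℂ := ⟨fun μ a => μ.1 a⟩

/-- The state `a ↦ μ (f a)`. -/
def StateSpace.pullback (f : A →⋆ₐ[ℂ] B) (μ : StateSpace B) : StateSpace A :=
  ⟨StrongDual.toWeakDual ((WeakDual.toStrongDual μ.1).comp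
      ⟨(f : A →ₐ[ℂ] B).toLinearMap, AddMonoidHomClass.continuous_of_bound f 1
        (by simpa only [one_mul] using NonUnitalStarAlgHom.norm_apply_le f)⟩),
    by
      change μ.1 (f 1) = 1
      rw [map_one, μ.2.1],
    fun a => by
      change 0 ≤ (μ.1 (f (star a * a))).re ∧ (μ.1 (f (star a * a))).im = 0
      rw [map_mul, map_star]
      exact μ.2.2 (f a)⟩

theorem StateSpace.pullback_apply (f : A →⋆ₐ[ℂ] B) (μ : StateSpace B) (a : A) :
    μ.pullback f a = μ (f a) := rfl

/-- Lipschitz seminorm: a *-invariant seminorm, possibly taking the value `∞`, that vanishes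
exactly on the scalars and is finite on a dense subspace. -/
structure IsLipschitzSeminorm (L : A → ℝ≥0∞) : Prop where
  add_le : ∀ a b, L (a + b) ≤ L a + L b
  smul : ∀ (c : ℂ) (a : A), L (c • a) = ‖c‖ₑ * L a
  star : ∀ a, L (star a) = L a
  eq_zero_iff : ∀ a, L a = 0 ↔ ∃ c : ℂ, a = algebraMap ℂ A c
  dense_dom : Dense {a | L a < ∞}

/-- The Monge-Kantorovich (extended) metric on the state space. -/
def mongeKantorovich (L : A → ℝ≥0∞) (μ ν : StateSpace A) : ℝ≥0∞ :=
  ⨆ (a : A) (_ : L a ≤ 1), ‖μ a - ν a‖ₑ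

/-- Lip-norm: a Lipschitz seminorm whose Monge-Kantorovich metric induces the weak* topology on the
state space. -/
structure IsLipNorm (L : A → ℝ≥0∞) : Prop extends IsLipschitzSeminorm L where
  isOpen_iff : ∀ U : Set (StateSpace A), IsOpen U ↔
    ∀ μ ∈ U, ∃ ε : ℝ≥0∞, 0 < ε ∧ ∀ ν, mongeKantorovich L μ ν < ε → ν ∈ U

end Lip

/-! ## Inductive sequences of compact quantum metric spaces -/

section Sequence

variable {A : ℕ → Type u} [∀ n, CStarAlgebra (A n)] (L : ∀ n, A n → ℝ≥0∞)
  (φ : ∀ n, A n →⋆ₐ[ℂ] A (n + 1))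

/-- `(A 0, L 0) → (A 1, L 1) → ⋯` is an inductive sequence of compact quantum metric spaces: each
`L n` is a Lip-norm, and the connecting maps send Lipschitz elements to Lipschitz elements. -/
structure IsInductiveSequence : Prop where
  isLipNorm : ∀ n, IsLipNorm (L n)
  map_dom : ∀ (n : ℕ) (a : A n), L n a < ∞ → L (n + 1) (φ n a) < ∞

/-- The metric `∑ 2⁻⁽ⁿ⁺¹⁾ ρₙ / (1 + ρₙ)` on the state space of the limit, where `ρₙ` is the
Monge-Kantorovich distance of the restrictions to `A n` (it is finite when `L n` is a Lip-norm). The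
terms are numbered from `0`, whence the exponent `n + 1`. -/
def limDist (μ ν : StateSpace (CStarLimit φ)) : ℝ≥0∞ :=
  ∑' n : ℕ, (2⁻¹ : ℝ≥0∞) ^ (n + 1) *
    (mongeKantorovich (L n) (μ.pullback (limMap φ n)) (ν.pullback (limMap φ n)) /
      (1 + mongeKantorovich (L n) (μ.pullback (limMap φ n)) (ν.pullback (limMap φ n))))

/-- The seminorm `sup |μ a - ν a| / ρ(μ, ν)` on the limit, over all pairs of distinct states, where
`ρ = limDist L φ`. -/
def limSeminorm (a : CStarLimit φ) : ℝ≥0∞ :=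
  ⨆ (μ : StateSpace (CStarLimit φ)) (ν : StateSpace (CStarLimit φ)) (_ : μ ≠ ν),
    ‖μ a - ν a‖ₑ / limDist L φ μ ν

end Sequence

end QMS

end

/-! The morphism of sequences acts termwise on eventually coherent sequences and contracts the limit
seminorm, so it extends to the completions. Its values are forced on the dense union of the images
of the `A n`, which gives uniqueness.

For the estimate, dualize. If `L ∘ Ψ` is at most `Γ * LA n` on each `A n`, then pulling two states
of the limit of the `B n` back to `A n` expands distances by at most `Γ`. Since `x / (1 + x) ≤ x`
and the weights `2⁻⁽ⁿ⁺¹⁾` sum to `1`, the same bound holds for `limDist`. By definition of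
`limSeminorm`, `Ψ a` therefore separates states at rate at most `Γ * limSeminorm LA φ a` relative to
the metric of `L`.

It remains to return from the metric to `L`. For lower semicontinuous `L` and self-adjoint `b`, such
a rate bounds `L b`: otherwise Hahn-Banach separates `b` from a closed sublevel set, and the Jordan
decomposition turns the separating functional into a multiple of a difference of two states
violating the bound. The factor `2` is the cost of splitting an element into real and imaginary
parts. -/

namespace QMS

open scoped ComplexStarModule


/-! ### States, positive functionals and the Jordan decomposition -/

section States

variable {A : Type u} [CStarAlgebra A]

/-- A state as a linear functional. -/
noncomputable def StateSpace.toLinearMap (μ : StateSpace A) : A →ₗ[ℂ] ℂ :=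
  (WeakDual.toStrongDual (Subtype.val μ)).toLinearMap

theorem StateSpace.toLinearMap_continuous (μ : StateSpace A) : Continuous μ.toLinearMap :=
  (WeakDual.toStrongDual (Subtype.val μ)).continuous

theorem StateSpace.toLinearMap_star_mul_self_im (μ : StateSpace A) (a : A) :
    (μ.toLinearMap (star a * a)).im = 0 := (μ.2.2 a).2

theorem StateSpace.toLinearMap_one (μ : StateSpace A) : μ.toLinearMap 1 = 1 := μ.2.1

/-- Polarization: only the reality of `μ (star a * a)` is needed, applied to `1 + b`. Replacing `a`
by `Complex.I • a` turns the statement on imaginary parts into the one on real parts. -/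
theorem StateSpace.toLinearMap_star (μ : StateSpace A) (a : A) :
    μ.toLinearMap (star a) = star (μ.toLinearMap a) := by
  have him : ∀ b : A, (μ.toLinearMap (star b)).im = -(μ.toLinearMap b).im := fun b => by
    have h := μ.toLinearMap_star_mul_self_im (1 + b)
    have e : star (1 + b) * (1 + b) = 1 + b + star b + star b * b := by
      rw [star_add, star_one]; noncomm_ring
    rw [e, map_add, map_add, map_add, μ.toLinearMap_one] at h
    simp only [Complex.add_im, Complex.one_im, μ.toLinearMap_star_mul_self_im] at h
    linarith
  have h2 := him (Complex.I • a)
  rw [star_smul, map_smul, map_smul] at h2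
  refine Complex.ext ?_ (him a)
  simp at h2
  simpa using h2

theorem StateSpace.toLinearMap_realPart (μ : StateSpace A) (a : A) :
    μ.toLinearMap (ℜ a : A) = ((μ.toLinearMap a).re : ℂ) := by
  have h : (ℜ a : A) = ((2⁻¹ : ℝ) : ℂ) • (a + star a) := by
    rw [realPart_apply_coe]; exact (Complex.coe_smul _ _).symm
  rw [h, map_smul, map_add, μ.toLinearMap_star]
  apply Complex.ext <;> simp
  ring

theorem StateSpace.toLinearMap_imaginaryPart (μ : StateSpace A) (a : A) :
    μ.toLinearMap (ℑ a : A) = ((μ.toLinearMap a).im : ℂ) := by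
  have h := μ.toLinearMap_realPart (-Complex.I • a)
  rw [neg_smul, map_neg, realPart_I_smul, neg_neg, map_neg, map_smul] at h
  simpa using h

theorem StateSpace.ext_toLinearMap {μ ν : StateSpace A}
    (h : ∀ a, μ.toLinearMap a = ν.toLinearMap a) : μ = ν :=
  Subtype.ext (DFunLike.ext _ _ h)

/-- A linear functional on the self-adjoint part that is nonnegative on positive elements. -/
def IsPositiveFunctional (g : selfAdjoint A →ₗ[ℝ] ℝ) : Prop :=
  ∀ x : selfAdjoint A, (∃ a : A, (x : A) = star a * a) → 0 ≤ g x

/-- Apply `g` to the positive elements `‖x‖ • 1 - x` and `x + ‖x‖ • 1`. Thus positivity alone yields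
continuity. -/
theorem IsPositiveFunctional.abs_le {g : selfAdjoint A →ₗ[ℝ] ℝ} (hg : IsPositiveFunctional g)
    (x : selfAdjoint A) : |g x| ≤ g 1 * ‖x‖ := by
  let _ := CStarAlgebra.spectralOrder A
  let _ := CStarAlgebra.spectralOrderedRing A
  have h1 := (selfAdjoint.isSelfAdjoint (x := x)).le_algebraMap_norm_self
  have h2 := (selfAdjoint.isSelfAdjoint (x := x)).neg_algebraMap_norm_le_self
  have e : ((‖x‖ • (1 : selfAdjoint A) : selfAdjoint A) : A) = algebraMap ℝ A ‖(x : A)‖ := by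
    rw [Algebra.algebraMap_eq_smul_one]; rfl
  have k1 := hg (‖x‖ • 1 - x) (CStarAlgebra.nonneg_iff_eq_star_mul_self.1 (by
    rw [AddSubgroupClass.coe_sub, e]; exact sub_nonneg.2 h1))
  have k2 := hg (x + ‖x‖ • 1) (CStarAlgebra.nonneg_iff_eq_star_mul_self.1 (by
    rw [AddMemClass.coe_add, e]; exact neg_le_iff_add_nonneg.1 h2))
  simp only [map_sub, map_add, map_smul, smul_eq_mul] at k1 k2
  rw [_root_.abs_le]
  constructor <;> linarith

/-- The state is the complexification `a ↦ g (ℜ a) + i g (ℑ a)`. -/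
theorem IsPositiveFunctional.exists_state {g : selfAdjoint A →ₗ[ℝ] ℝ}
    (hg : IsPositiveFunctional g) (h1 : g 1 = 1) :
    ∃ μ : StateSpace A, ∀ a : A, (μ.toLinearMap a).re = g (ℜ a) := by
  let G : StrongDual ℝ A := (g ∘ₗ realPart).mkContinuous 1 fun a => by
    refine (hg.abs_le (ℜ a)).trans ?_
    rw [h1]
    exact mul_le_mul_of_nonneg_left (realPart.norm_le a) zero_le_one
  have hG : ∀ a, G a = g (ℜ a) := fun a => rfl
  let μ : WeakDual ℂ A := StrongDual.toWeakDual (StrongDual.extendRCLike G)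
  have hμ : ∀ a, μ a = (g (ℜ a) : ℂ) + Complex.I * (g (ℑ a) : ℂ) := fun a => by
    change StrongDual.extendRCLike (𝕜 := ℂ) G a = _
    rw [StrongDual.extendRCLike_apply, hG, hG]
    simp [realPart_I_smul]
  have hsa : ∀ a : A, IsSelfAdjoint a → μ a = (g (ℜ a) : ℂ) := fun a ha => by
    rw [hμ, ha.imaginaryPart]; simp
  refine ⟨⟨μ, ?_, fun a => ?_⟩, fun a => ?_⟩
  · rw [hsa 1 (IsSelfAdjoint.one A)]
    have : ℜ (1 : A) = 1 := selfAdjoint.realPart_coe (x := 1)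
    rw [this, h1, Complex.ofReal_one]
  · rw [hsa _ (IsSelfAdjoint.star_mul_self a)]
    exact ⟨hg _ ⟨a, (IsSelfAdjoint.star_mul_self a).coe_realPart⟩, Complex.ofReal_im _⟩
  · change (μ a).re = _
    rw [hμ]; simp

/-- Jordan decomposition of a bounded Hermitian functional on a unital C*-algebra. -/
theorem exists_positive_sub_positive (f : StrongDual ℝ (selfAdjoint A)) :
    ∃ g h : selfAdjoint A →ₗ[ℝ] ℝ, IsPositiveFunctional g ∧ IsPositiveFunctional h ∧
      ∀ x, f x = g x - h x := by
  let _ := CStarAlgebra.spectralOrder A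
  let _ := CStarAlgebra.spectralOrderedRing A
  have hmul : ∀ (c : ℝ) (a : A), 0 ≤ c → 0 ≤ a → 0 ≤ c • a := fun c a hc ha => by
    obtain ⟨b, rfl⟩ := CStarAlgebra.nonneg_iff_eq_star_mul_self.1 ha
    refine CStarAlgebra.nonneg_iff_eq_star_mul_self.2 ⟨Real.sqrt c • b, ?_⟩
    rw [star_smul, star_trivial (Real.sqrt c), smul_mul_smul_comm, Real.mul_self_sqrt hc]
  let V := selfAdjoint A
  -- The decomposition is read off from an M. Riesz extension. The extra real coordinate measures
  -- how far `x` and `y` may fall below zero, and is charged at the price `‖f‖`.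
  let s : PointedCone ℝ (V × V × ℝ) :=
    { carrier := {p | 0 ≤ (p.1 : A) + p.2.2 • (1 : A) ∧ 0 ≤ (p.2.1 : A) + p.2.2 • (1 : A)}
      add_mem' := by
        rintro p q ⟨hp, hp'⟩ ⟨hq, hq'⟩
        refine ⟨(add_nonneg hp hq).trans_eq ?_, (add_nonneg hp' hq').trans_eq ?_⟩ <;>
        · simp only [Prod.fst_add, Prod.snd_add, AddMemClass.coe_add, add_smul]; abel
      zero_mem' := by simp
      smul_mem' := by
        rintro c p ⟨hp, hp'⟩
        refine ⟨(hmul c _ c.2 hp).trans_eq ?_, (hmul c _ c.2 hp').trans_eq ?_⟩ <;>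
        · rw [smul_add, smul_smul]; rfl }
  have hs : ∀ p : V × V × ℝ, p ∈ s ↔
      0 ≤ (p.1 : A) + p.2.2 • (1 : A) ∧ 0 ≤ (p.2.1 : A) + p.2.2 • (1 : A) := fun _ => Iff.rfl
  let F : V × V × ℝ →ₗ[ℝ] ℝ :=
    (f : V →ₗ[ℝ] ℝ) ∘ₗ LinearMap.fst ℝ V (V × ℝ) +
      ‖f‖ • (LinearMap.snd ℝ V ℝ ∘ₗ LinearMap.snd ℝ V (V × ℝ))
  have hF : ∀ p, F p = f p.1 + ‖f‖ * p.2.2 := fun _ => rfl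
  -- On the antidiagonal `y = -x` the functional is prescribed by `f`; a positive extension `G` then
  -- splits `f x = G (x, -x, 0)` as `G (x, 0, 0) - G (0, x, 0)`.
  let D : Submodule ℝ (V × V × ℝ) := LinearMap.ker
    (LinearMap.fst ℝ V (V × ℝ) + LinearMap.fst ℝ V ℝ ∘ₗ LinearMap.snd ℝ V (V × ℝ))
  have hD : ∀ p : V × V × ℝ, p ∈ D ↔ p.1 + p.2.1 = 0 := fun _ => Iff.rfl
  have hnorm : ∀ x : V, 0 ≤ (x : A) + ‖x‖ • (1 : A) := fun x => by
    rw [← Algebra.algebraMap_eq_smul_one]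
    exact neg_le_iff_add_nonneg.1 (selfAdjoint.isSelfAdjoint (x := x)).neg_algebraMap_norm_le_self
  have hone : ∀ {r t : ℝ} {x : V}, r ≤ t → 0 ≤ (x : A) + r • (1 : A) →
      0 ≤ (x : A) + t • (1 : A) := fun {r t x} hrt h => by
    have := add_nonneg h (hmul (t - r) 1 (sub_nonneg.2 hrt) zero_le_one)
    rwa [add_assoc, ← add_smul, add_sub_cancel] at this
  have key := riesz_extension s ⟨D, F ∘ₗ D.subtype⟩ ?_ ?_
  · obtain ⟨G, hG, hpos⟩ := key
    have hpos1 : ∀ x : V, 0 ≤ (x : A) → 0 ≤ G (x, 0, 0) := fun x hx =>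
      hpos _ ((hs _).2 (by simpa using hx))
    have hpos2 : ∀ x : V, 0 ≤ (x : A) → 0 ≤ G (0, x, 0) := fun x hx =>
      hpos _ ((hs _).2 (by simpa using hx))
    refine ⟨G ∘ₗ LinearMap.inl ℝ V (V × ℝ),
      G ∘ₗ LinearMap.inr ℝ V (V × ℝ) ∘ₗ LinearMap.inl ℝ V ℝ, fun x hx => ?_, fun x hx => ?_,
      fun x => ?_⟩
    · exact hpos1 x (CStarAlgebra.nonneg_iff_eq_star_mul_self.2 hx)
    · exact hpos2 x (CStarAlgebra.nonneg_iff_eq_star_mul_self.2 hx)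
    · have h := hG ⟨(x, -x, 0), (hD _).2 (add_neg_cancel x)⟩
      have e : ((x, -x, 0) : V × V × ℝ) = (x, 0, 0) - (0, x, 0) := by simp
      have hf : F (x, -x, 0) = f x := by simp [hF]
      change G (x, -x, 0) = F (x, -x, 0) at h
      rw [e, map_sub, ← e, hf] at h
      exact h.symm
  · rintro ⟨⟨x, y, t⟩, hp⟩ hmem
    have hy : y = -x := eq_neg_of_add_eq_zero_right ((hD _).1 hp)
    subst hy
    change 0 ≤ F (x, -x, t)
    obtain ⟨h1, h2⟩ := (hs _).1 hmem
    simp only [NegMemClass.coe_neg] at h1 h2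
    rw [hF]
    -- Membership in the cone says `-t ≤ x ≤ t`, hence `‖x‖ ≤ t`, because `‖x‖` or `-‖x‖` lies in
    -- the spectrum. The zero algebra has empty spectrum and is treated apart.
    have hxt : ‖f x‖ ≤ ‖f‖ * t := by
      rcases subsingleton_or_nontrivial A with hA | hA
      · have : f = 0 := ContinuousLinearMap.ext fun y => by
          rw [Subsingleton.elim y 0, map_zero, map_zero]
        simp [this]
      · refine (f.le_opNorm x).trans (mul_le_mul_of_nonneg_left ?_ (norm_nonneg f))
        have hx := selfAdjoint.isSelfAdjoint (x := x)
        rcases CStarAlgebra.norm_or_neg_norm_mem_spectrum (a := (x : A)) hx with h | h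
        · refine (le_algebraMap_iff_spectrum_le (a := (x : A)) (r := t)).1 ?_ _ h
          rw [Algebra.algebraMap_eq_smul_one]
          exact sub_nonneg.1 (h2.trans_eq (neg_add_eq_sub _ _))
        · refine neg_le_neg_iff.1
            ((algebraMap_le_iff_le_spectrum (a := (x : A)) (r := -t)).1 ?_ _ h)
          rw [Algebra.algebraMap_eq_smul_one, neg_smul]
          exact neg_le_iff_add_nonneg.2 h1
    have := neg_le_of_abs_le hxt
    dsimp only
    linarith
  · rintro ⟨x, y, t⟩
    -- Raising the last coordinate to `max ‖x‖ ‖y‖` brings any point into the cone without leaving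
    -- `D`.
    refine ⟨⟨(0, 0, max ‖x‖ ‖y‖ - t), (hD _).2 (add_zero 0)⟩, ?_⟩
    change ((0 : V), (0 : V), max ‖x‖ ‖y‖ - t) + (x, y, t) ∈ s
    rw [hs]
    simp only [Prod.mk_add_mk, zero_add, sub_add_cancel]
    exact ⟨hone (le_max_left _ _) (hnorm x), hone (le_max_right _ _) (hnorm y)⟩

end States

/-! ### Recovering a Lipschitz seminorm from its metric -/

section Seminorm

variable {A : Type u} [CStarAlgebra A] {L : A → ℝ≥0∞}

theorem IsLipschitzSeminorm.real_smul (hL : IsLipschitzSeminorm L) {c : ℝ} (hc : 0 ≤ c) (a : A) :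
    L (c • a) = ENNReal.ofReal c * L a := by
  rw [← Complex.coe_smul, hL.smul, ← ofReal_norm, Complex.norm_of_nonneg hc]

theorem IsLipschitzSeminorm.realPart_le (hL : IsLipschitzSeminorm L) (a : A) :
    L (ℜ a : A) ≤ L a := by
  rw [realPart_apply_coe, hL.real_smul (by norm_num)]
  calc _ ≤ ENNReal.ofReal 2⁻¹ * (L a + L a) := by
        gcongr
        exact (hL.add_le _ _).trans_eq (by rw [hL.star])
    _ = L a := by
        rw [← two_mul, ← mul_assoc, ← ENNReal.ofReal_ofNat, ← ENNReal.ofReal_mul (by norm_num)]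
        norm_num

theorem le_mongeKantorovich {μ ν : StateSpace A} {a : A} (ha : L a ≤ 1) :
    ‖μ.toLinearMap a - ν.toLinearMap a‖ₑ ≤ mongeKantorovich L μ ν :=
  le_iSup₂ (f := fun (a : A) (_ : L a ≤ 1) => ‖μ.toLinearMap a - ν.toLinearMap a‖ₑ) a ha

theorem mongeKantorovich_le {μ ν : StateSpace A} {r : ℝ≥0∞}
    (h : ∀ a, L a ≤ 1 → ‖μ.toLinearMap a - ν.toLinearMap a‖ₑ ≤ r) :
    mongeKantorovich L μ ν ≤ r := iSup₂_le h

/-- Bipolar argument: the sublevel set of `L` at `C` is convex, and closed by semicontinuity. A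
functional separating `b` from it kills `1`, so the two halves of its Jordan decomposition have
equal mass and normalize to states. -/
theorem IsLipschitzSeminorm.le_of_isSelfAdjoint_of_pos (hL : IsLipschitzSeminorm L)
    (hsc : LowerSemicontinuous L) {b : A} (hb : IsSelfAdjoint b) {C : ℝ} (hC : 0 < C)
    (h : ∀ μ ν : StateSpace A, ‖μ.toLinearMap b - ν.toLinearMap b‖ₑ ≤
      ENNReal.ofReal C * mongeKantorovich L μ ν) : L b ≤ ENNReal.ofReal C := by
  by_contra hbC
  have hconv : Convex ℝ (L ⁻¹' Set.Iic (ENNReal.ofReal C)) := by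
    intro x hx y hy s t hs ht hst
    calc L (s • x + t • y) ≤ ENNReal.ofReal s * L x + ENNReal.ofReal t * L y := by
          rw [← hL.real_smul hs, ← hL.real_smul ht]; exact hL.add_le _ _
      _ ≤ ENNReal.ofReal s * ENNReal.ofReal C + ENNReal.ofReal t * ENNReal.ofReal C := by
          gcongr <;> assumption
      _ = ENNReal.ofReal C := by
          rw [← add_mul, ← ENNReal.ofReal_add hs ht, hst, ENNReal.ofReal_one, one_mul]
  obtain ⟨F, s, hFs, hsF⟩ := geometric_hahn_banach_closed_point hconv
    (hsc.isClosed_preimage (ENNReal.ofReal C)) hbC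
  -- The sublevel set contains the whole line of real scalars, on which `F` is bounded above.
  have hscal : ∀ t : ℝ, t * F 1 < s := fun t => by
    rw [← smul_eq_mul, ← map_smul]
    refine hFs _ ?_
    have : L (t • (1 : A)) = 0 := (hL.eq_zero_iff _).2 ⟨t, by
      rw [Algebra.algebraMap_eq_smul_one, Complex.coe_smul]⟩
    simp [this]
  have hF1 : F 1 = 0 := by
    by_contra hne
    have := hscal (s / F 1)
    rw [div_mul_cancel₀ _ hne] at this
    exact lt_irrefl _ this
  have hs0 : 0 < s := by simpa using hscal 0
  let f : StrongDual ℝ (selfAdjoint A) :=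
    ⟨{ toFun := fun x => F x
       map_add' := fun x y => map_add F (x : A) y
       map_smul' := fun c x => map_smul F c (x : A) }, F.continuous.comp continuous_subtype_val⟩
  obtain ⟨g, k, hg, hk, hfgk⟩ := exists_positive_sub_positive f
  have hfF : ∀ x : selfAdjoint A, F x = g x - k x := hfgk
  have hgk : k 1 = g 1 := by
    have := hfF 1
    rw [selfAdjoint.val_one, hF1] at this
    linarith
  set c := g 1 with hc
  have hbre : (ℜ b : A) = b := hb.coe_realPart
  have hFb : F b = g (ℜ b) - k (ℜ b) := by rw [← hfF, hbre]
  -- If the common mass were zero, both positive parts would vanish, giving `F b = 0 < s < F b`.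
  have hc0 : 0 < c := by
    refine lt_of_le_of_ne (hg 1 ⟨1, by simp⟩) fun h0 => ?_
    have h1 := hg.abs_le (ℜ b)
    have h2 := hk.abs_le (ℜ b)
    rw [hgk] at h2
    rw [← hc] at h1
    rw [← h0, zero_mul, abs_nonpos_iff] at h1 h2
    rw [h1, h2] at hFb
    linarith
  have hscale : ∀ {p : selfAdjoint A →ₗ[ℝ] ℝ}, IsPositiveFunctional p →
      IsPositiveFunctional (c⁻¹ • p) := fun hp x hx =>
    mul_nonneg (inv_nonneg.2 hc0.le) (hp x hx)
  obtain ⟨μ, hμ⟩ := (hscale hg).exists_state (inv_mul_cancel₀ hc0.ne')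
  obtain ⟨ν, hν⟩ := (hscale hk).exists_state (by
    rw [LinearMap.smul_apply, hgk]; exact inv_mul_cancel₀ hc0.ne')
  have hdiff : ∀ a, (μ.toLinearMap a - ν.toLinearMap a).re = c⁻¹ * F (ℜ a : A) := fun a => by
    rw [Complex.sub_re, hμ, hν, hfF]; simp [mul_sub]
  have hMK : mongeKantorovich L μ ν ≤ ENNReal.ofReal (c⁻¹ * (s / C)) := by
    refine mongeKantorovich_le fun a ha => ?_
    -- A phase makes the difference real and nonnegative, so it is seen by `F` on `ℜ (θ • a)`;
    -- neither rotation nor the real part increases `L`.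
    obtain ⟨θ, hθ, hθz⟩ : ∃ θ : ℂ, ‖θ‖ = 1 ∧
        θ * (μ.toLinearMap a - ν.toLinearMap a) = ‖μ.toLinearMap a - ν.toLinearMap a‖ := by
      obtain ⟨θ, h1, h2⟩ := RCLike.exists_norm_eq_mul_self (μ.toLinearMap a - ν.toLinearMap a)
      exact ⟨θ, h1, h2.symm⟩
    have hmem : F (C • (ℜ (θ • a) : A)) < s := by
      refine hFs _ ?_
      change L _ ≤ _
      rw [hL.real_smul hC.le]
      refine mul_le_of_le_one_right' ((hL.realPart_le _).trans ?_)
      rwa [hL.smul, ← ofReal_norm, hθ, ENNReal.ofReal_one, one_mul]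
    rw [map_smul, smul_eq_mul] at hmem
    rw [← ofReal_norm]
    refine ENNReal.ofReal_le_ofReal ?_
    have e := hdiff (θ • a)
    rw [map_smul, map_smul, smul_eq_mul, smul_eq_mul, ← mul_sub, hθz, Complex.ofReal_re] at e
    rw [e]
    refine mul_le_mul_of_nonneg_left ?_ (inv_nonneg.2 hc0.le)
    rw [le_div_iff₀ hC, mul_comm]
    exact hmem.le
  have h1 : ENNReal.ofReal (c⁻¹ * F b) ≤ ENNReal.ofReal (c⁻¹ * s) := by
    calc ENNReal.ofReal (c⁻¹ * F b)
        ≤ ‖μ.toLinearMap b - ν.toLinearMap b‖ₑ := by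
          rw [← ofReal_norm]
          refine ENNReal.ofReal_le_ofReal ?_
          have := hdiff b
          rw [hbre] at this
          rw [← this]
          exact Complex.re_le_norm _
      _ ≤ ENNReal.ofReal C * ENNReal.ofReal (c⁻¹ * (s / C)) := (h μ ν).trans (by gcongr)
      _ = ENNReal.ofReal (c⁻¹ * s) := by
          rw [← ENNReal.ofReal_mul hC.le]
          congr 1
          field_simp
  rw [ENNReal.ofReal_le_ofReal_iff (by positivity)] at h1
  exact absurd (le_of_mul_le_mul_left h1 (inv_pos.2 hc0)) (not_le.2 hsF)

/-- A lower semicontinuous Lipschitz seminorm is recovered on self-adjoint elements from its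
Monge-Kantorovich metric. -/
theorem IsLipschitzSeminorm.le_of_isSelfAdjoint (hL : IsLipschitzSeminorm L)
    (hsc : LowerSemicontinuous L) {b : A} (hb : IsSelfAdjoint b) {C : ℝ≥0∞}
    (h : ∀ μ ν : StateSpace A, mongeKantorovich L μ ν ≠ ∞ → ‖μ.toLinearMap b - ν.toLinearMap b‖ₑ ≤
      C * mongeKantorovich L μ ν) : L b ≤ C := by
  -- The slack `ε` makes the constant positive, so that pairs of states at infinite distance impose
  -- no condition, even when `C = 0`.
  refine ENNReal.le_of_forall_pos_le_add fun ε hε hC => ?_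
  have e : C + ε = ENNReal.ofReal (C.toReal + ε) := by
    rw [ENNReal.ofReal_add ENNReal.toReal_nonneg ε.coe_nonneg, ENNReal.ofReal_toReal hC.ne,
      ENNReal.ofReal_coe_nnreal]
  rw [e]
  refine hL.le_of_isSelfAdjoint_of_pos hsc hb (by positivity) fun μ ν => ?_
  rw [← e]
  by_cases hfin : mongeKantorovich L μ ν = ∞
  · rw [hfin, ENNReal.mul_top (by positivity)]
    exact le_top
  · refine (h μ ν hfin).trans ?_
    gcongr
    exact le_self_add

/-- States are Hermitian, so the hypothesis passes to `ℜ b` and `ℑ b`; each contributes one `C`. -/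
theorem IsLipschitzSeminorm.le_two_mul (hL : IsLipschitzSeminorm L)
    (hsc : LowerSemicontinuous L) {b : A} {C : ℝ≥0∞}
    (h : ∀ μ ν : StateSpace A, mongeKantorovich L μ ν ≠ ∞ → ‖μ.toLinearMap b - ν.toLinearMap b‖ₑ ≤
      C * mongeKantorovich L μ ν) : L b ≤ 2 * C := by
  have hre : L (ℜ b : A) ≤ C := hL.le_of_isSelfAdjoint hsc (ℜ b).2 fun μ ν hfin => by
    refine le_trans ?_ (h μ ν hfin)
    rw [μ.toLinearMap_realPart, ν.toLinearMap_realPart, ← Complex.ofReal_sub, ← Complex.sub_re,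
      enorm_le_iff_norm_le, Complex.norm_real]
    exact Complex.abs_re_le_norm _
  have him : L (ℑ b : A) ≤ C := hL.le_of_isSelfAdjoint hsc (ℑ b).2 fun μ ν hfin => by
    refine le_trans ?_ (h μ ν hfin)
    rw [μ.toLinearMap_imaginaryPart, ν.toLinearMap_imaginaryPart, ← Complex.ofReal_sub,
      ← Complex.sub_im, enorm_le_iff_norm_le, Complex.norm_real]
    exact Complex.abs_im_le_norm _
  calc L b = L ((ℜ b : A) + Complex.I • (ℑ b : A)) := by rw [realPart_add_I_smul_imaginaryPart]
    _ ≤ L (ℜ b : A) + ‖Complex.I‖ₑ * L (ℑ b : A) := (hL.add_le _ _).trans_eq (by rw [hL.smul])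
    _ ≤ C + C := by
        rw [← ofReal_norm, Complex.norm_I, ENNReal.ofReal_one, one_mul]
        exact add_le_add hre him
    _ = 2 * C := (two_mul C).symm

/-- Rescale `a` by `r⁻¹`, whence the restriction to finite nonzero `r`. -/
theorem IsLipschitzSeminorm.enorm_sub_le (hL : IsLipschitzSeminorm L) {μ ν : StateSpace A}
    {r : ℝ≥0∞} (hr : r ≠ ∞) (hr0 : r ≠ 0) {a : A} (ha : L a ≤ r) :
    ‖μ.toLinearMap a - ν.toLinearMap a‖ₑ ≤ r * mongeKantorovich L μ ν := by
  have ht : 0 < r.toReal := ENNReal.toReal_pos hr0 hr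
  have hofReal : ENNReal.ofReal r.toReal⁻¹ = r⁻¹ := by
    rw [ENNReal.ofReal_inv_of_pos ht, ENNReal.ofReal_toReal hr]
  have h1 : L (((r.toReal⁻¹ : ℝ) : ℂ) • a) ≤ 1 := by
    rw [Complex.coe_smul, hL.real_smul (inv_nonneg.2 ht.le), hofReal]
    exact (mul_le_mul_right ha _).trans_eq (ENNReal.inv_mul_cancel hr0 hr)
  have h2 := le_mongeKantorovich (μ := μ) (ν := ν) h1
  rw [map_smul, map_smul, ← smul_sub, enorm_smul, ← ofReal_norm,
    Complex.norm_of_nonneg (inv_nonneg.2 ht.le), hofReal] at h2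
  calc _ = r * (r⁻¹ * ‖μ.toLinearMap a - ν.toLinearMap a‖ₑ) := by
        rw [← mul_assoc, ENNReal.mul_inv_cancel hr0 hr, one_mul]
    _ ≤ _ := by gcongr

theorem IsLipschitzSeminorm.toLinearMap_eq_of_mongeKantorovich_eq_zero
    (hL : IsLipschitzSeminorm L) {μ ν : StateSpace A} (h : mongeKantorovich L μ ν = 0) (a : A) :
    μ.toLinearMap a = ν.toLinearMap a := by
  refine congr_fun (μ.toLinearMap_continuous.ext_on hL.dense_dom ν.toLinearMap_continuous
    fun x hx => ?_) a
  -- The added `1` keeps the radius nonzero when `x` is a scalar.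
  have h0 := hL.enorm_sub_le (μ := μ) (ν := ν) (r := L x + 1)
    (ENNReal.add_ne_top.2 ⟨ne_of_lt hx, ENNReal.one_ne_top⟩) (by simp) le_self_add
  rw [h, mul_zero, nonpos_iff_eq_zero, enorm_eq_zero] at h0
  exact sub_eq_zero.1 h0

end Seminorm

/-! ### The induced morphism of inductive limits -/

section LimitMap

variable {A : ℕ → Type u} {B : ℕ → Type v} [∀ n, CStarAlgebra (A n)] [∀ n, CStarAlgebra (B n)]
  {φ : ∀ n, A n →⋆ₐ[ℂ] A (n + 1)} {φ' : ∀ n, B n →⋆ₐ[ℂ] B (n + 1)}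
  (ψ : ∀ n, A n →⋆ₐ[ℂ] B n) (hψ : ∀ n, (ψ (n + 1)).comp (φ n) = (φ' n).comp (ψ n))

/-- Termwise application of a morphism of inductive sequences. -/
def preLimitMap : PreLimit φ →⋆ₐ[ℂ] PreLimit φ' where
  toFun x := Subtype.mk (p := (· ∈ coherent φ')) (fun n => ψ n (x.term n)) <| by
    change ∀ᶠ n in atTop, _
    filter_upwards [x.eventually_coherent] with n hn
    rw [← hn]
    exact (DFunLike.congr_fun (hψ n) (x.term n)).symm
  map_one' := Subtype.ext (funext fun n => map_one (ψ n))
  map_zero' := Subtype.ext (funext fun n => map_zero (ψ n))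
  map_mul' x y := Subtype.ext (funext fun n => map_mul (ψ n) (x.term n) (y.term n))
  map_add' x y := Subtype.ext (funext fun n => map_add (ψ n) (x.term n) (y.term n))
  map_star' x := Subtype.ext (funext fun n => map_star (ψ n) (x.term n))
  commutes' r := Subtype.ext (funext fun n => AlgHomClass.commutes (ψ n) r)

theorem norm_preLimitMap_le (x : PreLimit φ) : ‖preLimitMap ψ hψ x‖ ≤ ‖x‖ :=
  le_of_tendsto_of_tendsto' (PreLimit.tendsto_norm (preLimitMap ψ hψ x)) x.tendsto_norm fun n =>
    NonUnitalStarAlgHom.norm_apply_le (ψ n) (x.term n)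

theorem uniformContinuous_preLimitMap : UniformContinuous (preLimitMap ψ hψ) :=
  (AddMonoidHomClass.lipschitz_of_bound (preLimitMap ψ hψ) 1 fun x => by
    exact (norm_preLimitMap_le ψ hψ x).trans_eq (one_mul ‖x‖).symm).uniformContinuous

/-- The map of completions underlying `limitMap`. -/
noncomputable def limitMapFun : CStarLimit φ → CStarLimit φ' :=
  UniformSpace.Completion.map (preLimitMap ψ hψ)

theorem continuous_limitMapFun : Continuous (limitMapFun ψ hψ) :=
  UniformSpace.Completion.continuous_map

theorem limitMapFun_ofPre (x : PreLimit φ) :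
    limitMapFun ψ hψ (ofPre φ x) = ofPre φ' (preLimitMap ψ hψ x) :=
  UniformSpace.Completion.map_coe (uniformContinuous_preLimitMap ψ hψ) x

theorem denseRange_ofPre : DenseRange (ofPre φ) := UniformSpace.Completion.denseRange_coe

/-- The unital *-homomorphism of limits induced by a morphism of inductive sequences. -/
noncomputable def limitMap : CStarLimit φ →⋆ₐ[ℂ] CStarLimit φ' where
  toFun := limitMapFun ψ hψ
  commutes' r := by
    rw [← ofPre_algebraMap, limitMapFun_ofPre, ← ofPre_algebraMap, AlgHomClass.commutes]
  map_one' := by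
    rw [← map_one (algebraMap ℂ (CStarLimit φ)), ← ofPre_algebraMap, limitMapFun_ofPre,
      AlgHomClass.commutes, ofPre_algebraMap, map_one]
  map_zero' := by
    rw [← map_zero (algebraMap ℂ (CStarLimit φ)), ← ofPre_algebraMap, limitMapFun_ofPre,
      AlgHomClass.commutes, ofPre_algebraMap, map_zero]
  map_mul' x y := by
    have hc := continuous_limitMapFun ψ hψ
    refine denseRange_ofPre.induction_on₂ (p := fun x y => limitMapFun ψ hψ (x * y) =
      limitMapFun ψ hψ x * limitMapFun ψ hψ y) ?_ (fun x y => ?_) x y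
    · exact isClosed_eq (hc.comp continuous_mul)
        ((hc.comp continuous_fst).mul (hc.comp continuous_snd))
    · simp only [← ofPre_mul, limitMapFun_ofPre, map_mul]
  map_add' x y := by
    have hc := continuous_limitMapFun ψ hψ
    refine denseRange_ofPre.induction_on₂ (p := fun x y => limitMapFun ψ hψ (x + y) =
      limitMapFun ψ hψ x + limitMapFun ψ hψ y) ?_ (fun x y => ?_) x y
    · exact isClosed_eq (hc.comp continuous_add)
        ((hc.comp continuous_fst).add (hc.comp continuous_snd))
    · simp only [← ofPre_add, limitMapFun_ofPre, map_add]
  map_star' x := by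
    have hc := continuous_limitMapFun ψ hψ
    refine denseRange_ofPre.induction_on (p := fun x => limitMapFun ψ hψ (star x) =
      star (limitMapFun ψ hψ x)) x ?_ (fun x => ?_)
    · exact isClosed_eq (hc.comp continuous_star) hc.star
    · simp only [← ofPre_star, limitMapFun_ofPre, map_star]

theorem limitMap_comp_limMap (n : ℕ) :
    (limitMap ψ hψ).comp (limMap φ n) = (limMap φ' n).comp (ψ n) := by
  refine StarAlgHom.ext fun a => ?_
  refine (limitMapFun_ofPre ψ hψ _).trans (ofPre_orbit_eq ?_ fun m hm => ?_).symm
  · exact congr_arg (ψ n) (orbit_term_self φ n a)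
  · change φ' m (ψ m _) = ψ (m + 1) _
    rw [← orbit_coherent φ hm]
    exact (DFunLike.congr_fun (hψ m) _).symm

end LimitMap

/-! ### Metric and seminorm on the limit -/

section LimitLip

variable {A : ℕ → Type u} [∀ n, CStarAlgebra (A n)] {φ : ∀ n, A n →⋆ₐ[ℂ] A (n + 1)}
  {LA : ∀ n, A n → ℝ≥0∞}

theorem continuous_starAlgHom {A : Type u} {B : Type v} [CStarAlgebra A] [CStarAlgebra B]
    (f : A →⋆ₐ[ℂ] B) : Continuous f :=
  AddMonoidHomClass.continuous_of_bound f 1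
    (by simpa only [one_mul] using NonUnitalStarAlgHom.norm_apply_le f)

theorem limMap_induction {P : CStarLimit φ → Prop} (hP : IsClosed {a | P a})
    (h : ∀ n a, P (limMap φ n a)) (a : CStarLimit φ) : P a := by
  have : (⋃ n, Set.range (limMap φ n)) ⊆ {a | P a} := by
    rintro _ ⟨_, ⟨n, rfl⟩, a, rfl⟩
    exact h n a
  exact hP.closure_subset_iff.2 this (dense_iUnion_range_limMap φ a)

/-- Every term of the series vanishes, so the two states agree on each `A n`. Finiteness is
essential: in `ℝ≥0∞`, `∞ / (1 + ∞) = 0`, so infinite distances would go unseen. -/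
theorem eq_of_limDist_eq_zero (hLA : ∀ n, IsLipschitzSeminorm (LA n))
    {μ ν : StateSpace (CStarLimit φ)} (h : limDist LA φ μ ν = 0) (hfin : ∀ n,
      mongeKantorovich (LA n) (μ.pullback (limMap φ n)) (ν.pullback (limMap φ n)) ≠ ∞) :
    μ = ν := by
  refine StateSpace.ext_toLinearMap fun a => limMap_induction
    (P := fun a => μ.toLinearMap a = ν.toLinearMap a)
    (isClosed_eq μ.toLinearMap_continuous ν.toLinearMap_continuous) (fun n a => ?_) a
  have hn := ENNReal.tsum_eq_zero.1 h n
  have h0 : mongeKantorovich (LA n) (μ.pullback (limMap φ n)) (ν.pullback (limMap φ n)) = 0 := by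
    rcases mul_eq_zero.1 hn with h | h
    · simp at h
    · rcases ENNReal.div_eq_zero_iff.1 h with h | h
      · exact h
      · exact absurd h (ENNReal.add_ne_top.2 ⟨ENNReal.one_ne_top, hfin n⟩)
  exact (hLA n).toLinearMap_eq_of_mongeKantorovich_eq_zero h0 a

theorem limDist_le {μ ν : StateSpace (CStarLimit φ)} {r : ℝ≥0∞}
    (h : ∀ n, mongeKantorovich (LA n) (μ.pullback (limMap φ n)) (ν.pullback (limMap φ n)) ≤ r) :
    limDist LA φ μ ν ≤ r := by
  calc limDist LA φ μ ν ≤ ∑' n : ℕ, (2⁻¹ : ℝ≥0∞) ^ (n + 1) * r := by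
        refine ENNReal.tsum_le_tsum fun n => ?_
        gcongr
        refine (ENNReal.div_le_of_le_mul ?_).trans (h n)
        exact le_mul_of_one_le_right' le_self_add
    _ = r := by
        rw [ENNReal.tsum_mul_right, ENNReal.tsum_geometric_add_one, ENNReal.one_sub_inv_two, inv_inv,
          ENNReal.inv_mul_cancel two_ne_zero ENNReal.ofNat_ne_top, one_mul]

/-- Clearing the denominator in the supremum requires a nonzero finite distance; `hd` and `hd'`
provide this for distinct states. -/
theorem enorm_sub_le_limSeminorm_mul {μ ν : StateSpace (CStarLimit φ)}
    (hd : limDist LA φ μ ν = 0 → μ = ν) (hd' : limDist LA φ μ ν ≠ ∞) (a : CStarLimit φ) :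
    ‖μ.toLinearMap a - ν.toLinearMap a‖ₑ ≤ limSeminorm LA φ a * limDist LA φ μ ν := by
  by_cases hne : μ = ν
  · simp [hne]
  · have : ‖μ.toLinearMap a - ν.toLinearMap a‖ₑ / limDist LA φ μ ν ≤ limSeminorm LA φ a :=
      le_iSup₂_of_le (f := fun (μ ν : StateSpace (CStarLimit φ)) => ⨆ (_ : μ ≠ ν),
        ‖μ a - ν a‖ₑ / limDist LA φ μ ν) μ ν (le_iSup_of_le hne le_rfl)
    exact (ENNReal.div_le_iff (fun h => hne (hd h)) hd').1 this

end LimitLip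

end QMS

/-! ### The Lipschitz estimate -/

theorem proposition4p5
    {A : ℕ → Type u} {B : ℕ → Type v} [∀ n, CStarAlgebra (A n)] [∀ n, CStarAlgebra (B n)]
    (LA : ∀ n, A n → ℝ≥0∞) (LB : ∀ n, B n → ℝ≥0∞)
    (φ : ∀ n, A n →⋆ₐ[ℂ] A (n + 1)) (φ' : ∀ n, B n →⋆ₐ[ℂ] B (n + 1))
    (hA : QMS.IsInductiveSequence LA φ) (hB : QMS.IsInductiveSequence LB φ')
    (ψ : ∀ n, A n →⋆ₐ[ℂ] B n)
    (hψ : ∀ n, (ψ (n + 1)).comp (φ n) = (φ' n).comp (ψ n))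
    (L : QMS.CStarLimit φ' → ℝ≥0∞) (hL : QMS.IsLipNorm L) (hLsc : LowerSemicontinuous L)
    (γ : ℕ → ℝ) (hγ : BddAbove (Set.range γ))
    (hLγ : ∀ (n : ℕ) (a : A n),
      L (QMS.limMap φ' n (ψ n a)) ≤ ENNReal.ofReal (γ n) * LA n a) :
    ∃ Ψ : QMS.CStarLimit φ →⋆ₐ[ℂ] QMS.CStarLimit φ',
      (∀ n, Ψ.comp (QMS.limMap φ n) = (QMS.limMap φ' n).comp (ψ n)) ∧
      (∀ Ψ' : QMS.CStarLimit φ →⋆ₐ[ℂ] QMS.CStarLimit φ',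
        (∀ n, Ψ'.comp (QMS.limMap φ n) = (QMS.limMap φ' n).comp (ψ n)) → Ψ' = Ψ) ∧
      ∀ a : QMS.CStarLimit φ,
        L (Ψ a) ≤ ENNReal.ofReal (2 * ⨆ n, γ n) * QMS.limSeminorm LA φ a := by
  refine ⟨QMS.limitMap ψ hψ, QMS.limitMap_comp_limMap ψ hψ, fun Ψ' h' => ?_, fun a => ?_⟩
  · refine StarAlgHom.ext fun a => QMS.limMap_induction
      (P := fun a => Ψ' a = QMS.limitMap ψ hψ a) (isClosed_eq (QMS.continuous_starAlgHom _)
        (QMS.continuous_starAlgHom _)) (fun n a => ?_) a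
    exact DFunLike.congr_fun ((h' n).trans (QMS.limitMap_comp_limMap ψ hψ n).symm) a
  · set Γ : ℝ≥0∞ := ENNReal.ofReal (⨆ n, γ n) with hΓ
    have hLΓ : ∀ n a, L (QMS.limMap φ' n (ψ n a)) ≤ Γ * LA n a := fun n a =>
      (hLγ n a).trans (by gcongr; exact ENNReal.ofReal_le_ofReal (le_ciSup hγ n))
    have hmap : ∀ n a, QMS.limitMap ψ hψ (QMS.limMap φ n a) = QMS.limMap φ' n (ψ n a) :=
      fun n a => DFunLike.congr_fun (QMS.limitMap_comp_limMap ψ hψ n) a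
    rw [ENNReal.ofReal_mul zero_le_two, ENNReal.ofReal_ofNat, mul_assoc]
    -- When `Γ = 0`, which includes a negative supremum, rescaling is impossible. Instead `0 * ∞ =
    -- 0` makes `L` vanish on the images of all the `A n`, and semicontinuity carries this to the
    -- limit.
    rcases eq_or_ne Γ 0 with h0 | h0
    · rw [← hΓ, h0, zero_mul, mul_zero]
      refine QMS.limMap_induction (P := fun a => L (QMS.limitMap ψ hψ a) ≤ 0)
        ((hLsc.isClosed_preimage 0).preimage (QMS.continuous_starAlgHom _)) (fun n a => ?_) a
      rw [hmap]
      simpa [h0] using hLΓ n a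
    · refine hL.le_two_mul hLsc fun μ ν hfin => ?_
      -- Elements with `LA n x ≤ 1` land where `L ≤ Γ`, so pullback to each level is `Γ`-Lipschitz.
      -- This also gives the finiteness needed to use `limDist`.
      have hρ : ∀ n, QMS.mongeKantorovich (LA n)
          ((μ.pullback (QMS.limitMap ψ hψ)).pullback (QMS.limMap φ n))
          ((ν.pullback (QMS.limitMap ψ hψ)).pullback (QMS.limMap φ n)) ≤
          Γ * QMS.mongeKantorovich L μ ν := fun n =>
        QMS.mongeKantorovich_le fun x hx => by
          change ‖μ.toLinearMap (QMS.limitMap ψ hψ (QMS.limMap φ n x)) -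
            ν.toLinearMap (QMS.limitMap ψ hψ (QMS.limMap φ n x))‖ₑ ≤ _
          rw [hmap]
          exact hL.enorm_sub_le ENNReal.ofReal_ne_top h0
            ((hLΓ n x).trans (mul_le_of_le_one_right' hx))
      have hfin' : Γ * QMS.mongeKantorovich L μ ν ≠ ∞ :=
        ENNReal.mul_ne_top ENNReal.ofReal_ne_top hfin
      have hd := QMS.limDist_le hρ
      calc _ ≤ QMS.limSeminorm LA φ a * QMS.limDist LA φ (μ.pullback (QMS.limitMap ψ hψ))
              (ν.pullback (QMS.limitMap ψ hψ)) :=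
            QMS.enorm_sub_le_limSeminorm_mul (fun h => QMS.eq_of_limDist_eq_zero
              (fun n => (hA.isLipNorm n).toIsLipschitzSeminorm) h
              fun n => ne_top_of_le_ne_top hfin' (hρ n)) (ne_top_of_le_ne_top hfin' hd) a
        _ ≤ QMS.limSeminorm LA φ a * (Γ * QMS.mongeKantorovich L μ ν) := by gcongr
        _ = _ := by rw [← mul_assoc, mul_comm (QMS.limSeminorm LA φ a)]
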